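/- Let $q$ be a prime power and let $n\ge 1$. Equip $V=\mathbf F_{q^2}^n$ with the nondegenerate Hermitian form $$\langle u,v\rangle = c\sum_{i=1}^n(-1)^{i+1}u_i v_{n+1-i}^{\,q},$$ where $c\in\mathbf F_{q^2}$ is a constant with $c^{q-1}=(-1)^{n+1}$. Let $\mathrm{GU}_n(q)$ be the group of all $\mathbf F_{q^2}$-linear automorphisms of $V$ preserving this form; it acts on the poset $L$, ordered by inclusion, of all subspaces $0\subsetneq U\subsetneq V$ that are totally isotropic ($U\subseteq U^\perp$). The reduced Euler characteristic of a finite poset $P$ is $\widetilde\chi(P)=\sum_{d\ge -1}(-1)^d c_d(P)$, where $c_d(P)$ is the number of chains in $P$ with $d+1$ elements (so $c_{-1}(P)=1$). For $r\ge 1$ put $$\widetilde\chi_r(\mathrm{GU}_n(q))=\frac1{|\mathrm{GU}_n(q)|}\sum_{X\in\mathrm{Hom}(\mathbf Z^r,\mathrm{GU}_n(q))}\widetilde\chi\bigl(L^{X(\mathbf Z^r)}\bigr),$$ where $L^{X(\mathbf Z^r)}$ is the induced subposet of those $U\in L$ that are invariant under $X(\mathbf Z^r)$. Then: 1. $-\widetilde\chi_1(\mathrm{GU}_n(q))$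 equals $1$ for $n=1$ and $0$ for every $n>1$. 2. $-\widetilde\chi_r(\mathrm{GU}_1(q))=(q+1)^{r-1}$ for every $r\ge 1$. -/

import Mathlib

/-- The reduced Euler characteristic of a finite poset `P`, i.e. of its order complex:
the alternating sum `∑_{d ≥ -1} (-1)^d c_d` where `c_d` is the number of `d`-simplices, that is of
chains with `d + 1` elements.  The empty chain is the single simplex of dimension `-1`. -/
noncomputable def reducedEulerChar (P : Type*) [PartialOrder P] [Finite P] : ℤ :=
  ∑ᶠ s : {s : Finset P // IsChain (· ≤ ·) (s : Set P)}, (-1) ^ (s.1.card + 1)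

/-- There are finitely many homomorphisms from `ℤ^r` to a finite group. -/
instance finite_hom_zpow (r : ℕ) (G : Type*) [Group G] [Finite G] :
    Finite (Multiplicative (Fin r → ℤ) →* G) := by
  have : AddGroup.FG (Fin r → ℤ) := Module.Finite.iff_addGroup_fg.mp inferInstance
  have : Group.FG (Multiplicative (Fin r → ℤ)) := inferInstance
  obtain ⟨S, hS⟩ := Group.fg_def.mp this
  exact Finite.of_injective (fun X (z : S) => X z.1) fun X Y h =>
    MonoidHom.eq_of_eqOn_dense hS fun z hz => congrFun h ⟨z, hz⟩

/-- The `r`th equivariant reduced Euler characteristic of the finite `G`-poset `P`: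
`1/|G|` times the sum, over all homomorphisms `X : ℤ^r → G`, of the reduced Euler characteristic of
the induced subposet of the elements of `P` that are fixed by the image of `X`. -/
noncomputable def equivariantReducedEulerChar (r : ℕ) (P G : Type*) [PartialOrder P] [Finite P]
    [Group G] [Finite G] [MulAction G P] : ℚ :=
  (1 / (Nat.card G : ℚ)) * ∑ᶠ X : Multiplicative (Fin r → ℤ) →* G,
    (reducedEulerChar {x : P // ∀ z, X z • x = x} : ℚ)

section Unitary

variable {F : Type*} [Field F]

/-- The form `⟨u,v⟩ = c ∑_{1 ≤ i ≤ n} (-1)^{i+1} u_i v_{n+1-i}^q` on `F^n` (coordinates are indexed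
from `0` here).  It is used for `|F| = q^2` and `c^{q-1} = (-1)^{n+1}`, when it is a nondegenerate
Hermitian form. -/
def unitaryForm (q n : ℕ) (c : F) (u v : Fin n → F) : F :=
  c * ∑ i : Fin n, (-1) ^ (i : ℕ) * u i * v (Fin.rev i) ^ q

/-- The general unitary group: all linear automorphisms of `F^n` that preserve the form. -/
def GU (q n : ℕ) (c : F) : Subgroup ((Fin n → F) ≃ₗ[F] (Fin n → F)) where
  carrier := {g | ∀ u v, unitaryForm q n c (g u) (g v) = unitaryForm q n c u v}
  mul_mem' {g h} hg hh u v := by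
    rw [LinearEquiv.mul_apply, LinearEquiv.mul_apply, hg, hh]
  one_mem' _ _ := rfl
  inv_mem' {g} hg u v := by
    rw [← hg]
    exact congrArg₂ _ (g.apply_symm_apply u) (g.apply_symm_apply v)

/-- The poset, under inclusion, of nontrivial proper subspaces of `F^n` that are totally isotropic
(`U ⊆ U^⊥`, that is, the form vanishes on `U`). -/
abbrev IsotropicPoset (q n : ℕ) (c : F) : Type _ :=
  {U : Submodule F (Fin n → F) //
    ⊥ < U ∧ U < ⊤ ∧ ∀ u ∈ U, ∀ v ∈ U, unitaryForm q n c u v = 0}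

/-- The general unitary group acts on totally isotropic subspaces by `g • U = g(U)`. -/
instance isotropicAction (q n : ℕ) (c : F) : MulAction (GU q n c) (IsotropicPoset q n c) where
  smul g U := ⟨U.1.map (g.1 : (Fin n → F) →ₗ[F] (Fin n → F)), by
    obtain ⟨U, h1, h2, h3⟩ := U
    refine ⟨?_, ?_, ?_⟩
    · rw [bot_lt_iff_ne_bot] at h1 ⊢
      intro h
      exact h1 (by simpa using h)
    · rw [lt_top_iff_ne_top] at h2 ⊢
      intro h
      apply h2
      rw [eq_top_iff]
      intro x _
      obtain ⟨y, hy, hyx⟩ := (h ▸ Submodule.mem_top : g.1 x ∈ U.map _)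
      exact g.1.injective hyx ▸ hy
    · rintro _ ⟨u, hu, rfl⟩ _ ⟨v, hv, rfl⟩
      exact (g.2 u v).trans (h3 u hu v hv)⟩
  one_smul U := Subtype.ext (Submodule.map_id U.1)
  mul_smul g h U := Subtype.ext (Submodule.map_comp
    (h.1 : (Fin n → F) →ₗ[F] (Fin n → F)) (g.1 : (Fin n → F) →ₗ[F] (Fin n → F)) U.1)

instance finite_linearAut (n : ℕ) [Finite F] : Finite ((Fin n → F) ≃ₗ[F] (Fin n → F)) :=
  Finite.of_injective (fun g => (g : (Fin n → F) → (Fin n → F))) DFunLike.coe_injective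

/-- `χ̃_r(GU_n(q))`: the `r`th equivariant reduced Euler characteristic of the general unitary group
acting on the poset of nontrivial totally isotropic subspaces. -/
noncomputable def chiGU [Finite F] (r q n : ℕ) (c : F) : ℚ :=
  equivariantReducedEulerChar r (IsotropicPoset q n c) (GU q n c)

end Unitary

/-!
Interchanging summations turns `∑_g χ̃(P^g)` into a signed sum, over the chains `s` of `P`, of the
orders of the pointwise stabilizers `G_s`. Chains without minimal elements of `P` are grouped with
the chains `{a} ∪ s`, for `a` a minimal element of `P` below `s`. If `G_s` permutes these `a`
transitively, then the orders `|G_{{a} ∪ s}|` add up to `|G_s|` and the group cancels.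

For the unitary group the minimal elements are the isotropic lines. A line `⟨x⟩` is mapped to
another one `⟨y⟩` by an isometry that preserves every totally isotropic subspace through both of
them: a single reflection along `x - y` if `⟨x, y⟩ ≠ 0`, when there is no such subspace, and
otherwise a product of two reflections, from `x` to `z` and from `z` to `y`, where `z` is an
isotropic vector with `⟨x, z⟩ = ⟨y, z⟩ = 1`. In dimension one the poset is empty, and the unitary
group is the abelian group of the `(q + 1)`-st roots of unity, which has order `q + 1`.
-/

section Burnside

open MulAction

theorem sum_card_stabilizer_of_coe_eq_orbit {G α : Type*} [Group G] [Finite G] [MulAction G α]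
    {X : Finset α} {b : α} (hX : (X : Set α) = orbit G b) :
    ∑ a ∈ X, Nat.card (stabilizer G a) = Nat.card G := by
  have hcard : ∀ a ∈ X, Nat.card (stabilizer G a) = Nat.card (stabilizer G b) := fun a ha =>
    Nat.card_congr (stabilizerEquivStabilizerOfOrbitRel (hX ▸ ha : a ∈ orbit G b)).toEquiv
  rw [Finset.sum_congr rfl hcard, Finset.sum_const, smul_eq_mul, ← Set.ncard_coe_finset, hX,
    ← Nat.card_coe_set_eq, ← Nat.card_prod, Nat.card_congr (orbitProdStabilizerEquivGroup G b)]

theorem card_stabilizer_fixingSubgroup {G α : Type*} [Group G] [MulAction G α] (s : Set α) (a : α) :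
    Nat.card (stabilizer (fixingSubgroup G s) a) = Nat.card (fixingSubgroup G (insert a s)) := by
  rw [← Subgroup.card_subtype]
  congr! 2
  ext g
  simp [mem_fixingSubgroup_iff, and_comm]

end Burnside

section Chains

open Finset

variable {P : Type*} [PartialOrder P]

open scoped Classical in
/-- The finite chains of `P`, i.e. the simplices of its order complex, the empty one included. -/
noncomputable def chains (P : Type*) [PartialOrder P] [Fintype P] : Finset (Finset P) :=
  {s | IsChain (· ≤ ·) (s : Set P)}

open scoped Classical in
/-- The minimal elements of `P` that lie below all of `s`. -/
noncomputable def minimalLowerBounds [Fintype P] (s : Finset P) : Finset P :=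
  {a | IsMin a ∧ ∀ x ∈ s, a ≤ x}

open scoped Classical in
theorem filter_not_isMin_insert {s : Finset P} (hs : ∀ x ∈ s, ¬ IsMin x) {a : P} (ha : IsMin a) :
    {x ∈ insert a s | ¬ IsMin x} = s := by
  rw [filter_insert, if_neg (not_not.2 ha), filter_true_of_mem hs]

variable [Fintype P]

theorem mem_chains {s : Finset P} : s ∈ chains P ↔ IsChain (· ≤ ·) (s : Set P) := by
  simp [chains]

theorem mem_minimalLowerBounds {s : Finset P} {a : P} :
    a ∈ minimalLowerBounds s ↔ IsMin a ∧ ∀ x ∈ s, a ≤ x := by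
  simp [minimalLowerBounds]

theorem minimalLowerBounds_nonempty [Nonempty P] {s : Finset P} (hs : s ∈ chains P) :
    (minimalLowerBounds s).Nonempty := by
  obtain ⟨b, hb⟩ : ∃ b : P, ∀ x ∈ s, b ≤ x := by
    rcases s.eq_empty_or_nonempty with rfl | hne
    · exact ⟨Classical.arbitrary P, by simp⟩
    · obtain ⟨b, hb⟩ := s.exists_minimal hne
      exact ⟨b, fun x hx => ((mem_chains.1 hs).total hb.1 hx).elim id (hb.2 hx)⟩
  obtain ⟨a, hab, ha⟩ := Finite.exists_le_minimal (p := fun _ : P => True) (a := b) trivial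
  exact ⟨a, mem_minimalLowerBounds.2 ⟨minimal_true.1 ha, fun x hx => hab.trans (hb x hx)⟩⟩

theorem insert_mem_chains [DecidableEq P] {s : Finset P} (hs : s ∈ chains P) {a : P}
    (ha : ∀ x ∈ s, a ≤ x) : insert a s ∈ chains P := by
  rw [mem_chains, coe_insert]
  exact (mem_chains.1 hs).insert fun x hx _ => Or.inl (ha x hx)

theorem mem_minimalLowerBounds_erase [DecidableEq P] {t : Finset P} (ht : t ∈ chains P) {a : P}
    (hat : a ∈ t) (ha : IsMin a) : a ∈ minimalLowerBounds (t.erase a) :=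
  mem_minimalLowerBounds.2 ⟨ha, fun _ hx =>
    ((mem_chains.1 ht).total hat (mem_of_mem_erase hx)).elim id fun h => ha h⟩

theorem not_isMin_of_mem_erase [DecidableEq P] {t : Finset P} (ht : t ∈ chains P) {a : P}
    (hat : a ∈ t) (ha : IsMin a) {x : P} (hx : x ∈ t.erase a) : ¬ IsMin x := fun hmin =>
  have hax := (mem_minimalLowerBounds.1 (mem_minimalLowerBounds_erase ht hat ha)).2 x hx
  ne_of_mem_erase hx (hmin.eq_of_le hax).symm

open scoped Classical in
theorem sum_chains_eq_sum_add_sum_insert {M : Type*} [AddCommMonoid M] (f : Finset P → M) :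
    ∑ t ∈ chains P, f t = ∑ s ∈ chains P with ∀ x ∈ s, ¬ IsMin x,
      (f s + ∑ a ∈ minimalLowerBounds s, f (insert a s)) := by
  rw [sum_add_distrib, ← sum_filter_add_sum_filter_not (chains P) fun t => ∀ x ∈ t, ¬ IsMin x,
    sum_sigma']
  congr 1
  symm
  refine sum_bij (fun p _ => insert p.2 p.1) ?_ ?_ ?_ fun _ _ => rfl
  · rintro ⟨s, a⟩ hsa
    simp only [mem_sigma, mem_filter, mem_minimalLowerBounds] at hsa ⊢
    exact ⟨insert_mem_chains hsa.1.1 hsa.2.2, fun h => h a (mem_insert_self a s) hsa.2.1⟩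
  · rintro ⟨s, a⟩ hsa ⟨s', a'⟩ hsa' h
    simp only [mem_sigma, mem_filter, mem_minimalLowerBounds] at hsa hsa' h
    obtain rfl : s = s' := by
      rw [← filter_not_isMin_insert hsa.1.2 hsa.2.1, h, filter_not_isMin_insert hsa'.1.2 hsa'.2.1]
    have ha : a ∈ insert a' s := h ▸ mem_insert_self a s
    rw [(mem_insert.1 ha).resolve_right fun has => hsa.1.2 a has hsa.2.1]
  · intro t ht
    simp only [mem_filter, not_forall, not_not] at ht
    obtain ⟨ht, a, hat, ha⟩ := ht
    refine ⟨⟨t.erase a, a⟩, ?_, insert_erase hat⟩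
    simp only [mem_sigma, mem_filter]
    exact ⟨⟨mem_chains.2 ((mem_chains.1 ht).mono (coe_subset.2 (erase_subset a t))),
      fun x hx => not_isMin_of_mem_erase ht hat ha hx⟩, mem_minimalLowerBounds_erase ht hat ha⟩

end Chains

section EulerCharacteristic

open Finset

variable {P : Type*} [PartialOrder P]

theorem reducedEulerChar_of_isEmpty [Finite P] [IsEmpty P] : reducedEulerChar P = -1 := by
  have : Unique {s : Finset P // IsChain (· ≤ ·) (s : Set P)} :=
    { default := ⟨∅, by simp⟩
      uniq := fun s => Subtype.ext (Finset.eq_empty_of_isEmpty s.1) }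
  rw [reducedEulerChar, finsum_unique, Finset.eq_empty_of_isEmpty (Subtype.val default)]
  simp

theorem reducedEulerChar_subtype_congr [Finite P] {p p' : P → Prop} (h : ∀ x, p x ↔ p' x) :
    reducedEulerChar {x : P // p x} = reducedEulerChar {x : P // p' x} := by
  obtain rfl : p = p' := funext fun x => propext (h x)
  rfl

open scoped Classical in
theorem reducedEulerChar_subtype [Fintype P] (p : P → Prop) :
    reducedEulerChar {x : P // p x} = ∑ s ∈ chains P with ∀ x ∈ s, p x, (-1) ^ (#s + 1) := by
  rw [reducedEulerChar, finsum_eq_sum_of_fintype]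
  refine sum_bij (fun s _ => s.1.map (Function.Embedding.subtype p)) ?_ ?_ ?_ ?_
  · rintro ⟨s, hs⟩ -
    simp only [mem_filter, mem_chains, coe_map, mem_map]
    refine ⟨?_, ?_⟩
    · rintro _ ⟨x, hx, rfl⟩ _ ⟨y, hy, rfl⟩ hxy
      exact hs hx hy fun h => hxy (congrArg _ h)
    · rintro _ ⟨x, -, rfl⟩
      exact x.2
  · rintro s - t - h
    exact Subtype.ext (map_injective _ h)
  · intro t ht
    simp only [mem_filter, mem_chains] at ht
    refine ⟨⟨t.subtype p, fun x hx y hy hxy => ?_⟩, mem_univ _, subtype_map_of_mem ht.2⟩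
    exact ht.1 (mem_subtype.1 hx) (mem_subtype.1 hy) (Subtype.coe_injective.ne hxy)
  · rintro s -
    rw [card_map]

theorem sum_reducedEulerChar_fixed {G : Type*} [Group G] [Fintype G] [Fintype P] [MulAction G P] :
    ∑ g : G, reducedEulerChar {x : P // g • x = x} =
      ∑ s ∈ chains P, (-1) ^ (#s + 1) * (Nat.card (fixingSubgroup G (s : Set P)) : ℤ) := by
  classical
  simp_rw [reducedEulerChar_subtype]
  rw [sum_comm' (t' := chains P) (s' := fun s => {g : G | ∀ x ∈ s, g • x = x}) (by simp [and_comm])]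
  refine sum_congr rfl fun s _ => ?_
  have hcard : #{g : G | ∀ x ∈ s, g • x = x} = Nat.card (fixingSubgroup G (s : Set P)) :=
    (Nat.subtype_card _ fun g => by simp [mem_fixingSubgroup_iff]).symm
  rw [sum_const, nsmul_eq_mul, mul_comm, hcard]

end EulerCharacteristic

section EquivariantEulerCharacteristic

open Finset MulAction

variable {P G : Type*} [Group G] [PartialOrder P] [MulAction G P]

theorem isMin_smul [CovariantClass G P (· • ·) (· ≤ ·)] {a : P} (ha : IsMin a) (g : G) :
    IsMin (g • a) := fun b hb => by
  have h : a ≤ g⁻¹ • b := ha (by simpa using smul_mono_right g⁻¹ hb)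
  simpa using smul_mono_right g h

variable (G) in
theorem coe_minimalLowerBounds_eq_orbit [CovariantClass G P (· • ·) (· ≤ ·)] [Fintype P]
    {s : Finset P} {b : P} (hb : b ∈ minimalLowerBounds s)
    (htrans : ∀ a ∈ minimalLowerBounds s, ∃ g ∈ fixingSubgroup G (s : Set P), g • b = a) :
    (minimalLowerBounds s : Set P) = orbit (fixingSubgroup G (s : Set P)) b := by
  ext a
  refine ⟨fun ha => ?_, ?_⟩
  · obtain ⟨g, hg, rfl⟩ := htrans a ha
    exact ⟨⟨g, hg⟩, rfl⟩
  · rintro ⟨⟨g, hg⟩, rfl⟩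
    rw [mem_fixingSubgroup_iff] at hg
    obtain ⟨hmin, hle⟩ := mem_minimalLowerBounds.1 hb
    exact mem_minimalLowerBounds.2
      ⟨isMin_smul hmin g, fun x hx => hg x hx ▸ smul_mono_right g (hle x hx)⟩

theorem sum_reducedEulerChar_fixed_eq_zero [CovariantClass G P (· • ·) (· ≤ ·)] [Fintype G]
    [Fintype P] [Nonempty P]
    (htrans : ∀ s ∈ chains P, ∀ a ∈ minimalLowerBounds s, ∀ b ∈ minimalLowerBounds s,
      ∃ g ∈ fixingSubgroup G (s : Set P), g • a = b) :
    ∑ g : G, reducedEulerChar {x : P // g • x = x} = 0 := by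
  classical
  rw [sum_reducedEulerChar_fixed, sum_chains_eq_sum_add_sum_insert]
  refine sum_eq_zero fun s hs => ?_
  rw [mem_filter] at hs
  obtain ⟨hs, hmin⟩ := hs
  obtain ⟨b, hb⟩ := minimalLowerBounds_nonempty hs
  have hfix : ∑ a ∈ minimalLowerBounds s, Nat.card (fixingSubgroup G (insert a s : Set P)) =
      Nat.card (fixingSubgroup G (s : Set P)) := by
    simp_rw [← card_stabilizer_fixingSubgroup]
    exact sum_card_stabilizer_of_coe_eq_orbit
      (coe_minimalLowerBounds_eq_orbit G hb (htrans s hs b hb))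
  have hinsert : ∀ a ∈ minimalLowerBounds s,
      (-1 : ℤ) ^ (#(insert a s) + 1) * Nat.card (fixingSubgroup G (↑(insert a s) : Set P)) =
        -((-1) ^ (#s + 1) * Nat.card (fixingSubgroup G (insert a s : Set P))) := fun a ha => by
    rw [card_insert_of_notMem fun has => hmin a has (mem_minimalLowerBounds.1 ha).1, coe_insert]
    ring
  rw [sum_congr rfl hinsert, sum_neg_distrib, ← mul_sum, ← Nat.cast_sum, hfix, add_neg_cancel]

/-- A homomorphism out of the infinite cyclic group is a choice of an element. -/
def equivHomInt (G : Type*) [Group G] : G ≃ (Multiplicative (Fin 1 → ℤ) →* G) :=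
  (zpowersHom G).trans <| MulEquiv.monoidHomCongrLeftEquiv <|
    AddEquiv.toMultiplicative (LinearEquiv.funUnique (Fin 1) ℤ ℤ).toAddEquiv.symm

theorem equivHomInt_apply (g : G) (z : Multiplicative (Fin 1 → ℤ)) :
    equivHomInt G g z = g ^ z.toAdd 0 := rfl

theorem forall_equivHomInt_smul_eq_iff {α : Type*} [MulAction G α] {g : G} {x : α} :
    (∀ z, equivHomInt G g z • x = x) ↔ g • x = x := by
  simp only [equivHomInt_apply]
  refine ⟨fun h => by simpa using h (Multiplicative.ofAdd fun _ => 1), fun h z => ?_⟩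
  exact (stabilizer G x).zpow_mem h _

variable (P G) in
theorem equivariantReducedEulerChar_one [Finite P] [Fintype G] :
    equivariantReducedEulerChar 1 P G =
      (∑ g : G, reducedEulerChar {x : P // g • x = x} : ℤ) / Nat.card G := by
  rw [equivariantReducedEulerChar, ← finsum_comp_equiv (equivHomInt G),
    finsum_eq_sum_of_fintype, Int.cast_sum, one_div_mul_eq_div]
  simp_rw [reducedEulerChar_subtype_congr fun _ => forall_equivHomInt_smul_eq_iff]

theorem equivariantReducedEulerChar_one_eq_zero [CovariantClass G P (· • ·) (· ≤ ·)] [Finite G]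
    [Fintype P] [Nonempty P]
    (htrans : ∀ s ∈ chains P, ∀ a ∈ minimalLowerBounds s, ∀ b ∈ minimalLowerBounds s,
      ∃ g ∈ fixingSubgroup G (s : Set P), g • a = b) :
    equivariantReducedEulerChar 1 P G = 0 := by
  have := Fintype.ofFinite G
  rw [equivariantReducedEulerChar_one, sum_reducedEulerChar_fixed_eq_zero htrans, Int.cast_zero,
    zero_div]

variable (P G) in
theorem equivariantReducedEulerChar_of_isEmpty [IsEmpty P] [Finite G] (r : ℕ) :
    equivariantReducedEulerChar r P G =
      -(Nat.card (Multiplicative (Fin r → ℤ) →* G) / Nat.card G) := by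
  have := Fintype.ofFinite (Multiplicative (Fin r → ℤ) →* G)
  simp_rw [equivariantReducedEulerChar, reducedEulerChar_of_isEmpty]
  rw [finsum_eq_sum_of_fintype, sum_const, card_univ, ← Nat.card_eq_fintype_card, nsmul_eq_mul,
    Int.cast_neg, Int.cast_one]
  ring

theorem card_hom_int_pow (r : ℕ) (G : Type*) [CommGroup G] :
    Nat.card (Multiplicative (Fin r → ℤ) →* G) = Nat.card G ^ r := by
  have e : (Multiplicative (Fin r → ℤ) →* G) ≃ (Fin r → Additive G) :=
    MonoidHom.toAdditiveRight.trans <| (addMonoidHomLequivInt ℤ).toEquiv.trans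
      ((Pi.basisFun ℤ (Fin r)).constr ℤ).symm.toEquiv
  rw [Nat.card_congr e, Nat.card_fun, Nat.card_congr Additive.toMul, Nat.card_fin]

end EquivariantEulerCharacteristic

section Involution

variable {F : Type*} [Field F] {φ : F →+* F}

theorem exists_add_map_ne_zero (hφ : φ ≠ RingHom.id F) : ∃ e, e + φ e ≠ 0 := by
  by_contra! h
  have hneg : ∀ e, φ e = -e := fun e => eq_neg_of_add_eq_zero_right (h e)
  have hone : (-1 : F) = 1 := by rw [← hneg, map_one]
  exact hφ (RingHom.ext fun e => by rw [hneg, ← neg_one_mul, hone, one_mul, RingHom.id_apply])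

theorem exists_add_map_eq (hφφ : Function.Involutive φ) (hφ : φ ≠ RingHom.id F) {t : F}
    (ht : φ t = t) : ∃ μ, μ + φ μ = t := by
  obtain ⟨e, he⟩ := exists_add_map_ne_zero hφ
  have hfix : φ (e + φ e) = e + φ e := by rw [map_add, hφφ, add_comm]
  refine ⟨t / (e + φ e) * e, ?_⟩
  rw [map_mul, map_div₀, hfix, ht, ← mul_add, div_mul_cancel₀ _ he]

theorem exists_ne_zero_map_eq_neg (hφφ : Function.Involutive φ) (hφ : φ ≠ RingHom.id F) :
    ∃ s ≠ 0, φ s = -s := by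
  obtain ⟨e, he⟩ : ∃ e, φ e ≠ e := by
    by_contra! h
    exact hφ (RingHom.ext h)
  exact ⟨e - φ e, sub_ne_zero.2 he.symm, by rw [map_sub, hφφ, neg_sub]⟩

end Involution

section Hermitian

variable {F V : Type*} [Field F] [AddCommGroup V] [Module F V] {φ : F →+* F}
  {B : V →ₛₗ[φ] V →ₗ[F] F}

/-- The unitary reflection `v ↦ v - β⁻¹ ⟨w, v⟩ w`. The condition `β + φ β = ⟨w, w⟩` makes it an
isometry when the form is Hermitian. For isotropic `w` it is a transvection. -/
noncomputable def unitaryReflection (B : V →ₛₗ[φ] V →ₗ[F] F) {w : V} {β : F} (hβ : β ≠ 0)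
    (hw : β + φ β = B w w) : V ≃ₗ[F] V :=
  LinearEquiv.dilatransvection (f := -(β⁻¹ • B w)) (v := w) <| by
    have h : 1 + (-(β⁻¹ • B w)) w = -(β⁻¹ * φ β) := by
      rw [LinearMap.neg_apply, LinearMap.smul_apply, smul_eq_mul, ← hw]
      field_simp
      ring
    rw [h, isUnit_iff_ne_zero]
    exact neg_ne_zero.2 (mul_ne_zero (inv_ne_zero hβ) ((map_ne_zero φ).2 hβ))

theorem unitaryReflection_apply {w : V} {β : F} (hβ : β ≠ 0) (hw : β + φ β = B w w) (v : V) :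
    unitaryReflection B hβ hw v = v - (β⁻¹ * B w v) • w := by
  rw [unitaryReflection, LinearEquiv.dilatransvection.apply, LinearMap.neg_apply,
    LinearMap.smul_apply, smul_eq_mul, neg_smul, sub_eq_add_neg]

theorem unitaryReflection_isometry (hB : B.IsSymm) {w : V} {β : F} (hβ : β ≠ 0)
    (hw : β + φ β = B w w) (u v : V) :
    B (unitaryReflection B hβ hw u) (unitaryReflection B hβ hw v) = B u v := by
  have hβ' : φ β ≠ 0 := (map_ne_zero φ).2 hβ
  simp only [unitaryReflection_apply, map_sub, LinearMap.map_smulₛₗ, map_mul, map_inv₀,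
    LinearMap.sub_apply, LinearMap.smul_apply, smul_eq_mul, RingHom.id_apply, hB.eq, ← hw]
  field_simp
  ring

theorem map_sub_add_map_eq (hB : B.IsSymm) {x y : V} (h : B x x = B y y) :
    B (x - y) x + φ (B (x - y) x) = B (x - y) (x - y) := by
  rw [hB.eq]
  simp only [map_sub, LinearMap.sub_apply]
  linear_combination h

theorem unitaryReflection_sub_apply {x y : V} (hβ : B (x - y) x ≠ 0)
    (hw : B (x - y) x + φ (B (x - y) x) = B (x - y) (x - y)) :
    unitaryReflection B hβ hw x = y := by
  rw [unitaryReflection_apply, inv_mul_cancel₀ hβ, one_smul, sub_sub_cancel]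

theorem exists_map_eq_one_and_map_eq_one (hB : B.SeparatingLeft) (hφφ : Function.Involutive φ)
    {x y : V} (hxy : LinearIndependent F ![x, y]) : ∃ a, B x a = 1 ∧ B y a = 1 := by
  obtain ⟨a, ha, hxa⟩ : ∃ a, B (x - y) a = 0 ∧ B x a ≠ 0 := by
    by_contra! h
    have hspan : B x ∈ Submodule.span F (Set.range fun _ : Unit => B (x - y)) :=
      mem_span_of_iInf_ker_le_ker fun a ha => h a (by simpa using ha)
    rw [Set.range_const, Submodule.mem_span_singleton] at hspan
    obtain ⟨k, hk⟩ := hspan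
    have hx : φ k • (x - y) - x = 0 := hB _ fun v => by
      rw [map_sub, LinearMap.map_smulₛₗ, hφφ, hk, sub_self, LinearMap.zero_apply]
    have hcoeff := LinearIndependent.pair_iff.1 hxy (φ k - 1) (-φ k) (by rw [← hx]; module)
    have : φ k = 0 := neg_eq_zero.1 hcoeff.2
    simp [this] at hcoeff
  have hya : B y a = B x a := by
    rw [map_sub, LinearMap.sub_apply, sub_eq_zero] at ha
    exact ha.symm
  exact ⟨(B x a)⁻¹ • a, by simp [hxa], by simp [hya, hxa]⟩

theorem exists_isotropic_map_eq_one (hB : B.IsSymm) (hsep : B.SeparatingLeft)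
    (hφφ : Function.Involutive φ) (hφ : φ ≠ RingHom.id F) {x y : V}
    (hxy : LinearIndependent F ![x, y]) (hx : B x x = 0) (hyx : B y x = 0) :
    ∃ z, B z z = 0 ∧ B x z = 1 ∧ B y z = 1 := by
  obtain ⟨a, hxa, hya⟩ := exists_map_eq_one_and_map_eq_one hsep hφφ hxy
  have hax : B a x = 1 := by rw [← hB.eq, hxa, map_one]
  obtain ⟨μ, hμ⟩ := exists_add_map_eq hφφ hφ (t := -B a a) (by rw [map_neg, hB.eq])
  refine ⟨a + μ • x, ?_, by simp [hxa, hx], by simp [hya, hyx]⟩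
  simp only [map_add, LinearMap.map_smulₛₗ, LinearMap.add_apply, LinearMap.smul_apply, smul_eq_mul,
    RingHom.id_apply, hx, hxa, hax]
  linear_combination hμ

theorem exists_isometry_of_map_eq_zero (hB : B.IsSymm) (hsep : B.SeparatingLeft)
    (hφφ : Function.Involutive φ) (hφ : φ ≠ RingHom.id F) {x y : V}
    (hxy : LinearIndependent F ![x, y]) (hx : B x x = 0) (hy : B y y = 0) (hyx : B y x = 0) :
    ∃ g : V ≃ₗ[F] V, (∀ u v, B (g u) (g v) = B u v) ∧ g x = y ∧
      ∀ u, B x u = 0 → B y u = 0 → ∃ t : F, g u = u + t • (y - x) := by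
  obtain ⟨z, hz, hxz, hyz⟩ := exists_isotropic_map_eq_one hB hsep hφφ hφ hxy hx hyx
  have hzx : B z x = 1 := by rw [← hB.eq, hxz, map_one]
  have hβ₁ : B (x - z) x = -1 := by simp [hx, hzx]
  have hβ₂ : B (z - y) z = -1 := by simp [hz, hyz]
  let g₁ := unitaryReflection B (hβ₁ ▸ neg_ne_zero.2 one_ne_zero)
    (map_sub_add_map_eq hB (hx.trans hz.symm))
  let g₂ := unitaryReflection B (hβ₂ ▸ neg_ne_zero.2 one_ne_zero)
    (map_sub_add_map_eq hB (hz.trans hy.symm))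
  refine ⟨g₁.trans g₂, fun u v => ?_, ?_, fun u hxu hyu => ⟨B z u, ?_⟩⟩
  · rw [LinearEquiv.trans_apply, LinearEquiv.trans_apply, unitaryReflection_isometry hB,
      unitaryReflection_isometry hB]
  · rw [LinearEquiv.trans_apply, unitaryReflection_sub_apply, unitaryReflection_sub_apply]
  · have hg₁ : g₁ u = u - B z u • (x - z) := by
      rw [unitaryReflection_apply, hβ₁]
      simp [hxu]
    have hg₂ : B (z - y) (g₁ u) = -B z u := by
      simp only [hg₁, map_sub, map_smul, LinearMap.sub_apply, smul_eq_mul, hyu, hzx, hz, hyx, hyz]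
      ring
    rw [LinearEquiv.trans_apply, unitaryReflection_apply, hg₂, hβ₂, hg₁]
    module

theorem exists_isometry_apply_eq (hB : B.IsSymm) (hsep : B.SeparatingLeft)
    (hφφ : Function.Involutive φ) (hφ : φ ≠ RingHom.id F) {x y : V}
    (hxy : LinearIndependent F ![x, y]) (hx : B x x = 0) (hy : B y y = 0) :
    ∃ g : V ≃ₗ[F] V, (∀ u v, B (g u) (g v) = B u v) ∧ g x = y ∧
      ∀ U : Submodule F V, x ∈ U → y ∈ U → (∀ u ∈ U, ∀ v ∈ U, B u v = 0) → ∀ u ∈ U, g u ∈ U := by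
  by_cases hyx : B y x = 0
  · obtain ⟨g, hg, hgx, hgu⟩ := exists_isometry_of_map_eq_zero hB hsep hφφ hφ hxy hx hy hyx
    refine ⟨g, hg, hgx, fun U hxU hyU hU u hu => ?_⟩
    obtain ⟨t, ht⟩ := hgu u (hU x hxU u hu) (hU y hyU u hu)
    exact ht ▸ U.add_mem hu (U.smul_mem t (U.sub_mem hyU hxU))
  · have hβ : B (x - y) x ≠ 0 := by simpa [hx] using hyx
    exact ⟨unitaryReflection B hβ (map_sub_add_map_eq hB (hx.trans hy.symm)),
      unitaryReflection_isometry hB _ _, unitaryReflection_sub_apply _ _,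
      fun U hxU hyU hU => absurd (hU y hyU x hxU) hyx⟩

end Hermitian

section Frobenius

variable {F : Type*} [Field F] [Finite F] {q : ℕ}

theorem one_lt_of_card_eq_sq (hF : Nat.card F = q ^ 2) : 1 < q := by
  have : 1 < q ^ 2 := hF ▸ Finite.one_lt_card
  exact (one_lt_pow_iff two_ne_zero).1 this

theorem exists_ringHom_eq_pow (hF : Nat.card F = q ^ 2) : ∃ φ : F →+* F, ∀ x, φ x = x ^ q := by
  have := Fintype.ofFinite F
  have hq : IsPrimePow q := by
    have := Fintype.isPrimePow_card_of_field (α := F)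
    rwa [← Nat.card_eq_fintype_card, hF, isPrimePow_pow_iff two_ne_zero] at this
  obtain ⟨p, k, hp, -, rfl⟩ := hq
  have : Fact p.Prime := ⟨hp.nat_prime⟩
  have : CharP F p := charP_of_card_eq_prime_pow (f := k * 2) (by
    rw [← Nat.card_eq_fintype_card, hF, pow_mul])
  exact ⟨iterateFrobenius F p k, fun x => iterateFrobenius_def p k x⟩

variable {φ : F →+* F}

theorem involutive_of_eq_pow (hF : Nat.card F = q ^ 2) (hφ : ∀ x, φ x = x ^ q) :
    Function.Involutive φ := fun x => by
  have := Fintype.ofFinite F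
  rw [hφ, hφ, ← pow_mul, ← sq, ← hF, Nat.card_eq_fintype_card, FiniteField.pow_card]

theorem ne_id_of_eq_pow (hF : Nat.card F = q ^ 2) (hφ : ∀ x, φ x = x ^ q) :
    φ ≠ RingHom.id F := by
  rintro rfl
  have := Fintype.ofFinite F
  have hq := one_lt_of_card_eq_sq hF
  have hpow : ∀ x : Fˣ, x ^ (q - 1) = 1 := fun x => by
    rw [← mul_left_inj x, ← pow_succ, Nat.sub_add_cancel hq.le, one_mul]
    exact Units.ext (by simpa using (hφ x).symm)
  have hdvd := (FiniteField.forall_pow_eq_one_iff F (q - 1)).1 hpow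
  rw [← Nat.card_eq_fintype_card, hF] at hdvd
  have hle := Nat.le_of_dvd (by omega) hdvd
  have : q < q ^ 2 := lt_self_pow₀ hq one_lt_two
  omega

end Frobenius

section Unitary

variable {F : Type*} [Field F] {q n : ℕ} {c : F} {φ : F →+* F}

theorem unitaryForm_smul_smul (k l : F) (u v : Fin n → F) :
    unitaryForm q n c (k • u) (l • v) = k * l ^ q * unitaryForm q n c u v := by
  simp only [unitaryForm, Pi.smul_apply, smul_eq_mul, Finset.mul_sum]
  exact Finset.sum_congr rfl fun i _ => by ring

theorem unitaryForm_single_left (i : Fin n) (v : Fin n → F) :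
    unitaryForm q n c (Pi.single i 1) v = c * ((-1) ^ (i : ℕ) * v i.rev ^ q) := by
  rw [unitaryForm, Finset.sum_eq_single i (fun j _ hj => by simp [hj]) (by simp)]
  simp

theorem unitaryForm_eq_div_mul {c₀ : F} (hc₀ : c₀ ≠ 0) (u v : Fin n → F) :
    unitaryForm q n c u v = c / c₀ * unitaryForm q n c₀ u v := by
  rw [unitaryForm, unitaryForm, ← mul_assoc, div_mul_cancel₀ _ hc₀]

/-- The form `unitaryForm` as a bundled sesquilinear map. Its arguments are swapped, since
sesquilinear forms are semilinear on the left in Mathlib. -/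
def unitarySesq (hφ : ∀ x, φ x = x ^ q) (n : ℕ) (c : F) :
    (Fin n → F) →ₛₗ[φ] (Fin n → F) →ₗ[F] F :=
  LinearMap.mk₂'ₛₗ φ (RingHom.id F) (fun u v => unitaryForm q n c v u)
    (fun u u' v => by
      simp only [unitaryForm, Pi.add_apply, ← hφ, map_add, mul_add, Finset.sum_add_distrib])
    (fun k u v => by
      simpa [hφ] using unitaryForm_smul_smul (c := c) 1 k v u)
    (fun u v v' => by
      simp only [unitaryForm, Pi.add_apply, mul_add, add_mul, Finset.sum_add_distrib])
    (fun k u v => by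
      simpa using unitaryForm_smul_smul (c := c) k 1 v u)

theorem unitarySesq_apply (hφ : ∀ x, φ x = x ^ q) (u v : Fin n → F) :
    unitarySesq hφ n c u v = unitaryForm q n c v u := rfl

theorem isSymm_unitarySesq (hφ : ∀ x, φ x = x ^ q) (hφφ : Function.Involutive φ)
    (hc : φ c = (-1) ^ (n + 1) * c) : (unitarySesq hφ n c).IsSymm where
  eq u v := by
    simp only [unitarySesq_apply, unitaryForm, map_mul, map_sum, map_pow, map_neg, map_one, hc,
      ← hφ, hφφ _]
    rw [← Equiv.sum_comp Fin.revPerm, Finset.mul_sum, Finset.mul_sum]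
    refine Finset.sum_congr rfl fun i _ => ?_
    simp only [Fin.revPerm_apply, Fin.rev_rev, Fin.val_rev]
    have hsign : (-1 : F) ^ (n + 1) * (-1) ^ (n - (i + 1)) = (-1) ^ (i : ℕ) := by
      rw [← pow_add, show n + 1 + (n - (i + 1)) = 2 * (n - i) + i by omega, pow_add, pow_mul]
      simp
    linear_combination (c * u i * φ (v i.rev)) * hsign

theorem separatingLeft_unitarySesq (hφ : ∀ x, φ x = x ^ q) (hc : c ≠ 0) :
    (unitarySesq hφ n c).SeparatingLeft := fun u hu => by
  ext i
  have hi := hu (Pi.single i.rev 1)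
  rw [unitarySesq_apply, unitaryForm_single_left, Fin.rev_rev, ← hφ] at hi
  simpa [hc] using hi

theorem exists_ne_zero_map_eq_neg_one_pow_mul (hφφ : Function.Involutive φ)
    (hφ : φ ≠ RingHom.id F) (m : ℕ) : ∃ c ≠ 0, φ c = (-1) ^ m * c := by
  rcases neg_one_pow_eq_or F m with h | h <;> rw [h]
  · exact ⟨1, one_ne_zero, by rw [map_one, one_mul]⟩
  · simpa using exists_ne_zero_map_eq_neg hφφ hφ

theorem exists_mem_GU_apply_eq [Finite F] (hF : Nat.card F = q ^ 2) (hc : c ≠ 0) {x y : Fin n → F}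
    (hxy : LinearIndependent F ![x, y]) (hx : unitaryForm q n c x x = 0)
    (hy : unitaryForm q n c y y = 0) :
    ∃ g ∈ GU q n c, g x = y ∧ ∀ U : Submodule F (Fin n → F), x ∈ U → y ∈ U →
      (∀ u ∈ U, ∀ v ∈ U, unitaryForm q n c u v = 0) → ∀ u ∈ U, g u ∈ U := by
  obtain ⟨φ, hφ⟩ := exists_ringHom_eq_pow hF
  have hφφ := involutive_of_eq_pow hF hφ
  have hφ1 := ne_id_of_eq_pow hF hφ
  -- Rescaling the form changes neither its isometries nor its isotropic subspaces.
  obtain ⟨c₀, hc₀, hφc₀⟩ := exists_ne_zero_map_eq_neg_one_pow_mul hφφ hφ1 (n + 1)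
  have hzero : ∀ {u v : Fin n → F}, unitaryForm q n c u v = 0 → unitaryForm q n c₀ u v = 0 :=
    fun {u v} h => by rw [unitaryForm_eq_div_mul hc, h, mul_zero]
  obtain ⟨g, hg, hgx, hgU⟩ := exists_isometry_apply_eq (isSymm_unitarySesq hφ hφφ hφc₀)
    (separatingLeft_unitarySesq hφ hc₀) hφφ hφ1 hxy (hzero hx) (hzero hy)
  refine ⟨g, fun u v => ?_, hgx, fun U hxU hyU hU =>
    hgU U hxU hyU fun u hu v hv => hzero (hU v hv u hu)⟩
  rw [unitaryForm_eq_div_mul hc₀, unitaryForm_eq_div_mul hc₀ u]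
  exact congrArg _ (hg v u)

end Unitary

namespace IsotropicPoset

variable {F : Type*} [Field F] {q n : ℕ} {c : F}

instance : CovariantClass (GU q n c) (IsotropicPoset q n c) (· • ·) (· ≤ ·) :=
  ⟨fun _ _ _ h => Submodule.map_mono h⟩

theorem exists_eq_span {U : IsotropicPoset q n c} (hU : IsMin U) :
    ∃ x, x ≠ 0 ∧ U.1 = F ∙ x := by
  obtain ⟨x, hx, hx0⟩ := U.1.ne_bot_iff.1 U.2.1.ne'
  have hle : F ∙ x ≤ U.1 := (Submodule.span_singleton_le_iff_mem _ _).2 hx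
  let W : IsotropicPoset q n c := ⟨F ∙ x, by simpa [bot_lt_iff_ne_bot] using hx0,
    hle.trans_lt U.2.2.1, fun u hu v hv => U.2.2.2 u (hle hu) v (hle hv)⟩
  exact ⟨x, hx0, le_antisymm (hU (b := W) hle) hle⟩

theorem smul_eq_of_forall_mem {g : GU q n c} {U W : IsotropicPoset q n c}
    (h : ∀ u ∈ U.1, g.1 u ∈ W.1) (hrank : Module.finrank F U.1 = Module.finrank F W.1) :
    g • U = W :=
  Subtype.ext <| Submodule.eq_of_le_of_finrank_eq (Submodule.map_le_iff_le_comap.2 h) <|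
    (LinearEquiv.finrank_map_eq g.1 U.1).trans hrank

theorem exists_smul_eq [Finite F] (hF : Nat.card F = q ^ 2) (hc : c ≠ 0)
    {a b : IsotropicPoset q n c} (ha : IsMin a) (hb : IsMin b) :
    ∃ g : GU q n c, g • a = b ∧ ∀ U, a ≤ U → b ≤ U → g • U = U := by
  by_cases hab : a = b
  · exact ⟨1, by rw [one_smul, hab], fun U _ _ => one_smul _ U⟩
  obtain ⟨x, hx0, hx⟩ := exists_eq_span ha
  obtain ⟨y, hy0, hy⟩ := exists_eq_span hb
  have hxa : x ∈ a.1 := hx ▸ Submodule.mem_span_singleton_self x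
  have hyb : y ∈ b.1 := hy ▸ Submodule.mem_span_singleton_self y
  have hxy : LinearIndependent F ![x, y] := (LinearIndependent.pair_iff' hx0).2 fun k hk =>
    hab <| (ha.eq_of_le <| show b.1 ≤ a.1 by
      rw [hy, Submodule.span_singleton_le_iff_mem, ← hk]
      exact a.1.smul_mem k hxa).symm
  obtain ⟨g, hg, hgx, hgU⟩ :=
    exists_mem_GU_apply_eq hF hc hxy (a.2.2.2 x hxa x hxa) (b.2.2.2 y hyb y hyb)
  refine ⟨⟨g, hg⟩, smul_eq_of_forall_mem ?_ ?_, fun U haU hbU =>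
    smul_eq_of_forall_mem (hgU U.1 (haU hxa) (hbU hyb) U.2.2.2) rfl⟩
  · rw [hx]
    intro u hu
    obtain ⟨k, rfl⟩ := Submodule.mem_span_singleton.1 hu
    rw [map_smul, hgx]
    exact b.1.smul_mem k hyb
  · rw [hx, hy, finrank_span_singleton hx0, finrank_span_singleton hy0]

theorem nonempty (hq : q ≠ 0) (hn : 1 < n) (c : F) : Nonempty (IsotropicPoset q n c) := by
  have : NeZero n := ⟨by omega⟩
  let x : Fin n → F := Pi.single 0 1
  have hx : x ≠ 0 := by simp [x]
  have hxx : unitaryForm q n c x x = 0 := by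
    have hrev : (0 : Fin n).rev ≠ 0 := by
      rw [Ne, Fin.ext_iff, Fin.val_rev, Fin.val_zero]
      omega
    simp [x, unitaryForm_single_left, hrev, hq]
  refine ⟨⟨F ∙ x, by simpa [bot_lt_iff_ne_bot] using hx, lt_top_iff_ne_top.2 fun h => ?_, ?_⟩⟩
  · have hrank := finrank_span_singleton (K := F) hx
    rw [h, finrank_top, Module.finrank_fin_fun] at hrank
    omega
  · intro u hu v hv
    obtain ⟨k, rfl⟩ := Submodule.mem_span_singleton.1 hu
    obtain ⟨l, rfl⟩ := Submodule.mem_span_singleton.1 hv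
    rw [unitaryForm_smul_smul, hxx, mul_zero]

instance isEmpty_one : IsEmpty (IsotropicPoset q 1 c) := by
  have : IsSimpleModule F (Fin 1 → F) := isSimpleModule_iff_finrank_eq_one.2 (by simp)
  exact ⟨fun U => (eq_bot_or_eq_top U.1).elim U.2.1.ne' U.2.2.1.ne⟩

end IsotropicPoset

section RankOne

variable {F : Type*} [Field F] {q : ℕ} {c : F}

theorem bijective_toModuleAut_of_finrank_eq_one {V : Type*} [AddCommGroup V] [Module F V]
    (hV : Module.finrank F V = 1) :
    Function.Bijective (DistribMulAction.toModuleAut F V : Fˣ →* V ≃ₗ[F] V) := by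
  have := Module.nontrivial_of_finrank_pos (R := F) (M := V) (by omega)
  obtain ⟨v, hv⟩ := exists_ne (0 : V)
  refine ⟨fun k l h => Units.ext (smul_left_injective F hv (LinearEquiv.congr_fun h v)),
    fun g => ?_⟩
  obtain ⟨k, hk, -⟩ := LinearMap.existsUnique_eq_smul_id_of_finrank_eq_one hV (g : V →ₗ[F] V)
  have hg : ∀ u, g u = k • u := LinearMap.congr_fun hk
  have hk0 : k ≠ 0 := by
    rintro rfl
    exact hv (g.injective (by rw [hg, zero_smul, map_zero]))
  exact ⟨Units.mk0 k hk0, LinearEquiv.ext fun u => (hg u).symm⟩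

theorem toModuleAut_mem_GU_one_iff (hc : c ≠ 0) (k : Fˣ) :
    DistribMulAction.toModuleAut F (Fin 1 → F) k ∈ GU q 1 c ↔ k ∈ rootsOfUnity (q + 1) F := by
  have hsmul : ∀ u v : Fin 1 → F, unitaryForm q 1 c (k • u) (k • v) =
      (k : F) ^ (q + 1) * unitaryForm q 1 c u v := fun u v => by
    rw [Units.smul_def, Units.smul_def, unitaryForm_smul_smul, pow_succ']
  rw [mem_rootsOfUnity']
  refine ⟨fun h => ?_, fun h u v => (hsmul u v).trans (by rw [h, one_mul])⟩
  have h1 := (hsmul 1 1).symm.trans (h 1 1)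
  have hne : unitaryForm q 1 c 1 1 ≠ 0 := by simpa [unitaryForm] using hc
  exact mul_right_cancel₀ hne (h1.trans (one_mul _).symm)

/-- The unitary group of a line consists of the scalars whose `(q + 1)`st power is one. -/
noncomputable def rootsOfUnityEquivGU (hc : c ≠ 0) : rootsOfUnity (q + 1) F ≃* GU q 1 c :=
  have hbij := bijective_toModuleAut_of_finrank_eq_one (F := F) (V := Fin 1 → F) (by simp)
  (Subgroup.equivMapOfInjective _ _ hbij.injective).trans <| MulEquiv.subgroupCongr <| by
    rw [← Subgroup.map_comap_eq_self_of_surjective hbij.surjective (GU q 1 c)]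
    congr 1
    ext k
    exact (toModuleAut_mem_GU_one_iff hc k).symm

theorem card_rootsOfUnity_add_one [Finite F] (hF : Nat.card F = q ^ 2) :
    Nat.card (rootsOfUnity (q + 1) F) = q + 1 := by
  rw [rootsOfUnity_eq_ker, IsCyclic.card_powMonoidHom_ker, Nat.card_units, hF]
  exact Nat.gcd_eq_right ⟨q - 1, by simpa using Nat.sq_sub_sq q 1⟩

end RankOne

section EulerCharacteristicUnitary

variable {F : Type*} [Field F] [Finite F] {q n : ℕ} {c : F}

theorem chiGU_one_eq_zero (hF : Nat.card F = q ^ 2) (hn : 1 < n) (hc : c ≠ 0) :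
    chiGU 1 q n c = 0 := by
  have := IsotropicPoset.nonempty (one_lt_of_card_eq_sq hF).ne_bot hn c
  have := Fintype.ofFinite (IsotropicPoset q n c)
  refine equivariantReducedEulerChar_one_eq_zero fun s _ a ha b hb => ?_
  rw [mem_minimalLowerBounds] at ha hb
  obtain ⟨g, hgab, hg⟩ := IsotropicPoset.exists_smul_eq hF hc ha.1 hb.1
  exact ⟨g, (mem_fixingSubgroup_iff _).2 fun U hU => hg U (ha.2 U hU) (hb.2 U hU), hgab⟩

theorem chiGU_rank_one (hF : Nat.card F = q ^ 2) (hc : c ≠ 0) (r : ℕ) :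
    -chiGU r q 1 c = ((q : ℚ) + 1) ^ r / (q + 1) := by
  have hhom : Nat.card (Multiplicative (Fin r → ℤ) →* GU q 1 c) = (q + 1) ^ r := by
    rw [← Nat.card_congr (MulEquiv.monoidHomCongrRightEquiv (rootsOfUnityEquivGU hc)),
      card_hom_int_pow, card_rootsOfUnity_add_one hF]
  rw [chiGU, equivariantReducedEulerChar_of_isEmpty, neg_neg, hhom,
    ← Nat.card_congr (rootsOfUnityEquivGU hc).toEquiv, card_rootsOfUnity_add_one hF]
  push_cast
  rfl

end EulerCharacteristicUnitary

theorem proposition5p1_general (q : ℕ) (F : Type*) [Field F] [Finite F]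
    (hF : Nat.card F = q ^ 2) :
    (∀ n : ℕ, 1 ≤ n → ∀ c : F, c ≠ 0 → -chiGU 1 q n c = if n = 1 then 1 else 0) ∧
    (∀ r : ℕ, 1 ≤ r → ∀ c : F, c ≠ 0 → -chiGU r q 1 c = ((q : ℚ) + 1) ^ (r - 1)) := by
  have hq : (q : ℚ) + 1 ≠ 0 := by positivity
  refine ⟨fun n hn c hc => ?_, fun r hr c hc => ?_⟩
  · split_ifs with h
    · rw [h, chiGU_rank_one hF hc, pow_one, div_self hq]
    · rw [chiGU_one_eq_zero hF (by omega) hc, neg_zero]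
  · rw [chiGU_rank_one hF hc, pow_sub₀ _ hq hr, pow_one, div_eq_mul_inv]

theorem proposition5p1 (q : ℕ) (hq : IsPrimePow q) (F : Type*) [Field F] [Finite F]
    (hF : Nat.card F = q ^ 2) :
    (∀ n : ℕ, 1 ≤ n → ∀ c : F, c ^ (q - 1) = (-1) ^ (n + 1) →
      -chiGU 1 q n c = if n = 1 then 1 else 0) ∧
    (∀ r : ℕ, 1 ≤ r → ∀ c : F, c ^ (q - 1) = (-1) ^ (1 + 1) →
      -chiGU r q 1 c = ((q : ℚ) + 1) ^ (r - 1)) := by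
  have hne : ∀ {n : ℕ} {c : F}, c ^ (q - 1) = (-1) ^ (n + 1) → c ≠ 0 := fun h =>
    ne_zero_pow (Nat.sub_ne_zero_of_lt hq.one_lt) (h ▸ by simp)
  exact (proposition5p1_general q F hF).imp (fun H n hn c hc => H n hn c (hne hc))
    fun H r hr c hc => H r hr c (hne hc)
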